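/- Let $\mathbf C$ be a symmetric monoidal dagger category: a symmetric monoidal category with an involutive, identity-on-objects functor $\dagger\colon \mathbf C^{\mathrm{op}}\to\mathbf C$ such that $(f\otimes g)^\dagger=f^\dagger\otimes g^\dagger$ and the associators, unitors and swap maps $\sigma$ are unitary (their daggers are their inverses). Let $(T,\mu,\eta)$ be a commutative strong Frobenius monad on $\mathbf C$, that is: - $T$ is a monad with $T(f^\dagger)=T(f)^\dagger$ for all morphisms $f$, and $T(\mu_A)\circ\mu_{T(A)}^\dagger=\mu_{T(A)}\circ T(\mu_A^\dagger)$ for all objects $A$; - $T$ is a strong monad, with strength a natural transformation $\mathrm{st}_{A,B}\colon A\otimes T(B)\to T(A\otimes B)$ satisfying, for $\alpha\colon A\otimes(B\otimes C)\to(A\otimes B)\otimes C$ and $\lambda\colon I\otimes A\to A$, the laws $\mathrm{st}\circ\alpha=T(\alpha)\circ\mathrm{st}\circ(\mathrm{id}\otimes\mathrm{st})$, $T(\lambda)\circ\mathrm{st}=\lambda$, $\mathrm{st}\circ(\mathrm{id}\otimes\mu)=\mu\circ T(\mathrm{st})\circ\mathrm{st}$ and $\mathrm{st}\circ(\mathrm{id}\otimes\eta)=\eta$;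 and each $\mathrm{st}_{A,B}$ is unitary; - writing $\mathrm{st}'_{A,B}=T(\sigma_{B,A})\circ\mathrm{st}_{B,A}\circ\sigma_{T(A),B}\colon T(A)\otimes B\to T(A\otimes B)$, the two maps $$\mathrm{dst}_{A,B}=\mu_{A\otimes B}\circ T(\mathrm{st}'_{A,B})\circ\mathrm{st}_{T(A),B},\qquad \mathrm{dst}'_{A,B}=\mu_{A\otimes B}\circ T(\mathrm{st}_{A,B})\circ\mathrm{st}'_{A,T(B)}$$ from $T(A)\otimes T(B)$ to $T(A\otimes B)$ are equal for all $A,B$. Then the Kleisli category $\mathbf C_T$ is a symmetric monoidal dagger category, with the following structure. The tensor product is $A\otimes_T B=A\otimes B$ on objects and $f\otimes_T g=\mathrm{dst}\circ(f\otimes g)$ on morphisms; the tensor unit is $I$; the associators, unitors and swap maps are the images of those of $\mathbf C$ under the canonical functor $\mathbf C\to\mathbf C_T$, $f\mapsto\eta\circ f$; and the dagger of a Kleisli morphism $f\colon A\to T(B)$ is $T(f^\dagger)\circ\mu_B^\dagger\circ\eta_B\colon B\to T(A)$. -/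

import Mathlib

open CategoryTheory MonoidalCategory

universe v u

/-- A dagger on a category: an involutive contravariant functor that is the identity on objects. -/
class DaggerCategory (C : Type u) [Category.{v} C] where
  /-- The dagger of a morphism. -/
  dag : ∀ {X Y : C}, (X ⟶ Y) → (Y ⟶ X)
  dag_id : ∀ X : C, dag (𝟙 X) = 𝟙 X
  dag_comp : ∀ {X Y Z : C} (f : X ⟶ Y) (g : Y ⟶ Z), dag (f ≫ g) = dag g ≫ dag f
  dag_dag : ∀ {X Y : C} (f : X ⟶ Y), dag (dag f) = f

namespace DaggerCategory

/-- A morphism is unitary when its dagger is its inverse. -/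
structure IsUnitary {C : Type u} [Category.{v} C] [DaggerCategory C] {X Y : C} (f : X ⟶ Y) :
    Prop where
  hom_dag : f ≫ dag f = 𝟙 X
  dag_hom : dag f ≫ f = 𝟙 Y

/-- A monoidal dagger category: the dagger is compatible with the tensor product of morphisms, and
the coherence isomorphisms are unitary. -/
class IsMonoidalDagger (C : Type u) [Category.{v} C] [MonoidalCategory C] [DaggerCategory C] :
    Prop where
  dag_tensor : ∀ {X₁ Y₁ X₂ Y₂ : C} (f : X₁ ⟶ Y₁) (g : X₂ ⟶ Y₂),
    dag (f ⊗ₘ g) = dag f ⊗ₘ dag g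
  unitary_associator : ∀ X Y Z : C, IsUnitary (α_ X Y Z).hom
  unitary_leftUnitor : ∀ X : C, IsUnitary (λ_ X).hom
  unitary_rightUnitor : ∀ X : C, IsUnitary (ρ_ X).hom

/-- A symmetric monoidal dagger category: moreover the swap maps are unitary. -/
class IsSymmetricMonoidalDagger (C : Type u) [Category.{v} C] [MonoidalCategory C]
    [SymmetricCategory C] [DaggerCategory C] : Prop extends IsMonoidalDagger C where
  unitary_braiding : ∀ X Y : C, IsUnitary (β_ X Y).hom

end DaggerCategory

open DaggerCategory

/-- A Frobenius monad on a dagger category: a monad whose underlying functor is a dagger functor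
and which satisfies the Frobenius law `T(μ_A) ∘ μ†_{T A} = μ_{T A} ∘ T(μ†_A)`. -/
structure IsFrobeniusMonad {C : Type u} [Category.{v} C] [DaggerCategory C] (T : Monad C) :
    Prop where
  map_dag : ∀ {X Y : C} (f : X ⟶ Y), T.map (dag f) = dag (T.map f)
  frobenius : ∀ A : C,
    dag (T.μ.app (T.obj A)) ≫ T.map (T.μ.app A) = T.map (dag (T.μ.app A)) ≫ T.μ.app (T.obj A)

/-- A strength on a monad `T` on a monoidal category, making it a strong monad. -/
structure MonadStrength {C : Type u} [Category.{v} C] [MonoidalCategory C] (T : Monad C) where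
  /-- The strength `A ⊗ T B ⟶ T (A ⊗ B)`. -/
  st : ∀ A B : C, A ⊗ T.obj B ⟶ T.obj (A ⊗ B)
  st_naturality : ∀ {A A' B B' : C} (f : A ⟶ A') (g : B ⟶ B'),
    (f ⊗ₘ T.map g) ≫ st A' B' = st A B ≫ T.map (f ⊗ₘ g)
  st_assoc : ∀ A B X : C,
    (α_ A B (T.obj X)).inv ≫ st (A ⊗ B) X =
      (𝟙 A ⊗ₘ st B X) ≫ st A (B ⊗ X) ≫ T.map (α_ A B X).inv
  st_unit : ∀ A : C, st (𝟙_ C) A ≫ T.map (λ_ A).hom = (λ_ (T.obj A)).hom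
  st_mu : ∀ A B : C,
    (𝟙 A ⊗ₘ T.μ.app B) ≫ st A B = st A (T.obj B) ≫ T.map (st A B) ≫ T.μ.app (A ⊗ B)
  st_eta : ∀ A B : C, (𝟙 A ⊗ₘ T.η.app B) ≫ st A B = T.η.app (A ⊗ B)

/-- A strong Frobenius monad: a Frobenius monad that is a strong monad with unitary strength. -/
structure IsStrongFrobeniusMonad {C : Type u} [Category.{v} C] [MonoidalCategory C]
    [DaggerCategory C] (T : Monad C) (s : MonadStrength T) : Prop
    extends IsFrobeniusMonad T where
  unitary_st : ∀ A B : C, IsUnitary (s.st A B)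

namespace MonadStrength

variable {C : Type u} [Category.{v} C] [MonoidalCategory C] [SymmetricCategory C] {T : Monad C}

/-- The costrength `st' : T A ⊗ B ⟶ T (A ⊗ B)`, obtained from the strength by swapping. -/
def st' (s : MonadStrength T) (A B : C) : T.obj A ⊗ B ⟶ T.obj (A ⊗ B) :=
  (β_ (T.obj A) B).hom ≫ s.st B A ≫ T.map (β_ B A).hom

/-- The double strength `dst = μ ∘ T(st') ∘ st`. -/
def dst (s : MonadStrength T) (A B : C) : T.obj A ⊗ T.obj B ⟶ T.obj (A ⊗ B) :=
  s.st (T.obj A) B ≫ T.map (s.st' A B) ≫ T.μ.app (A ⊗ B)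

/-- The other double strength `dst' = μ ∘ T(st) ∘ st'`. -/
def dst' (s : MonadStrength T) (A B : C) : T.obj A ⊗ T.obj B ⟶ T.obj (A ⊗ B) :=
  s.st' A (T.obj B) ≫ T.map (s.st A B) ≫ T.μ.app (A ⊗ B)

/-- A strong monad is commutative when the two double strengths coincide. -/
def IsCommutative (s : MonadStrength T) : Prop :=
  ∀ A B : C, s.dst A B = s.dst' A B

/-- The tensor product of Kleisli morphisms, `f ⊗ g = dst ∘ (f ⊗ g)`. -/
def kleisliTensorHom (s : MonadStrength T) {X₁ Y₁ X₂ Y₂ : Kleisli T} (f : X₁ ⟶ Y₁) (g : X₂ ⟶ Y₂) :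
    Kleisli.mk T (X₁.of ⊗ X₂.of) ⟶ Kleisli.mk T (Y₁.of ⊗ Y₂.of) :=
  Kleisli.Hom.mk ((f.of ⊗ₘ g.of) ≫ s.dst Y₁.of Y₂.of)

/-- The data (without any laws) of the monoidal structure on the Kleisli category: the tensor
product of objects is that of `C`, that of morphisms is given by the double strength, and the
coherence isomorphisms are the images of those of `C` under the canonical functor. -/
abbrev kleisliMonoidalStruct (s : MonadStrength T) : MonoidalCategoryStruct (Kleisli T) where
  tensorObj X Y := Kleisli.mk T (X.of ⊗ Y.of)
  whiskerLeft X _ _ f := s.kleisliTensorHom (𝟙 X) f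
  whiskerRight f Y := s.kleisliTensorHom f (𝟙 Y)
  tensorHom f g := s.kleisliTensorHom f g
  tensorUnit := Kleisli.mk T (𝟙_ C)
  associator X Y Z := (Kleisli.Adjunction.toKleisli T).mapIso (α_ X.of Y.of Z.of)
  leftUnitor X := (Kleisli.Adjunction.toKleisli T).mapIso (λ_ X.of)
  rightUnitor X := (Kleisli.Adjunction.toKleisli T).mapIso (ρ_ X.of)

end MonadStrength

/-- The given tensor product, unit and coherence isomorphisms satisfy the laws of a monoidal
category. -/
def IsMonoidalStruct {D : Type u} [Category.{v} D] (K : MonoidalCategoryStruct D) : Prop :=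
  ∃ M : MonoidalCategory D, M.toMonoidalCategoryStruct = K

/-- The monoidal category with exactly the given data, once the laws are known. -/
abbrev IsMonoidalStruct.monoidalCategory {D : Type u} [Category.{v} D]
    {K : MonoidalCategoryStruct D} (h : IsMonoidalStruct K) : MonoidalCategory D where
  toMonoidalCategoryStruct := K
  tensorHom_def := by obtain ⟨M, rfl⟩ := h; exact M.tensorHom_def
  id_tensorHom_id := by obtain ⟨M, rfl⟩ := h; exact M.id_tensorHom_id
  tensorHom_comp_tensorHom := by obtain ⟨M, rfl⟩ := h; exact M.tensorHom_comp_tensorHom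
  whiskerLeft_id := by obtain ⟨M, rfl⟩ := h; exact M.whiskerLeft_id
  id_whiskerRight := by obtain ⟨M, rfl⟩ := h; exact M.id_whiskerRight
  associator_naturality := by obtain ⟨M, rfl⟩ := h; exact M.associator_naturality
  leftUnitor_naturality := by obtain ⟨M, rfl⟩ := h; exact M.leftUnitor_naturality
  rightUnitor_naturality := by obtain ⟨M, rfl⟩ := h; exact M.rightUnitor_naturality
  pentagon := by obtain ⟨M, rfl⟩ := h; exact M.pentagon
  triangle := by obtain ⟨M, rfl⟩ := h; exact M.triangle

/-- The dagger on Kleisli morphisms: `f : A ⟶ T B` is sent to `T(f†) ∘ μ† ∘ η : B ⟶ T A`. -/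
def kleisliDag {C : Type u} [Category.{v} C] [DaggerCategory C] (T : Monad C)
    {X Y : Kleisli T} (f : X ⟶ Y) : Y ⟶ X :=
  Kleisli.Hom.mk (T.η.app Y.of ≫ dag (T.μ.app Y.of) ≫ T.map (dag f.of))

/-!
The Kleisli category of a strong monad carries two one-variable actions of `C`: `A ⊗ -`, given by
the strength (`kleisliLeft`), and its conjugate `- ⊗ A` by the swap maps (`kleisliRight`). The laws
of a strength say that `A ⊗ -` is functorial, restricts to `A ⊗ -` along the canonical
functor `C ⥤ Kleisli T`, and is natural in `A` and compatible with associators and left unitors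
(`kleisliLeft_id`, `kleisliLeft_comp`, `kleisliLeft_ofHom`, `kleisliLeft_naturality`,
`kleisliLeft_tensor`, `kleisliLeft_unit`). The same laws for `- ⊗ A` follow by conjugation.

Composing the two actions in either order computes one of the two double strengths, so that
commutativity of the monad is the interchange law (`kleisliRight_comp_kleisliLeft`), and the tensor
product of Kleisli morphisms is the composite of the two actions (`kleisliTensorHom_eq`). Every
naturality axiom of a symmetric monoidal category can thus be checked one variable at a time, while
the coherence axioms are images of those of `C`.

For the dagger, the Frobenius law together with a unit law gives `T(η) ≫ T(μ†) ≫ μ = μ†`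
(`IsFrobeniusMonad.map_eta_comp_map_dag_mu_comp_mu`) and `η ≫ T(μ†) ≫ μ = μ†`. The first makes the
Kleisli dagger functorial and the second makes it involutive. It extends the dagger of `C`, so
coherence maps and swaps stay unitary. Since the strength is unitary, taking the dagger of its
compatibility with `μ` shows that `A ⊗ -` preserves daggers (`kleisliDag_kleisliLeft`); hence so
does `- ⊗ A`, and with interchange the whole tensor product.
-/

/-! ### The canonical functor to the Kleisli category -/

section OfHom

variable {C : Type u} [Category.{v} C] (T : Monad C)

/-- The image of a morphism of `C` under the canonical functor to the Kleisli category, with source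
and target displayed as objects of the form `Kleisli.mk T A`. -/
def kleisliOfHom {A B : C} (f : A ⟶ B) : Kleisli.mk T A ⟶ Kleisli.mk T B :=
  (Kleisli.Adjunction.toKleisli T).map f

@[simp]
theorem kleisliOfHom_of {A B : C} (f : A ⟶ B) : (kleisliOfHom T f).of = f ≫ T.η.app B := rfl

theorem kleisliOfHom_id (A : C) : kleisliOfHom T (𝟙 A) = 𝟙 (Kleisli.mk T A) :=
  (Kleisli.Adjunction.toKleisli T).map_id A

theorem kleisliOfHom_comp {A B D : C} (f : A ⟶ B) (g : B ⟶ D) :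
    kleisliOfHom T f ≫ kleisliOfHom T g = kleisliOfHom T (f ≫ g) :=
  ((Kleisli.Adjunction.toKleisli T).map_comp f g).symm

theorem kleisliOfHom_comp_of {A B : C} {Y : Kleisli T} (f : A ⟶ B) (g : Kleisli.mk T B ⟶ Y) :
    (kleisliOfHom T f ≫ g).of = f ≫ g.of := by
  simp [← T.η.naturality_assoc g.of]

theorem comp_kleisliOfHom_of {X : Kleisli T} {A B : C} (f : X ⟶ Kleisli.mk T A) (g : A ⟶ B) :
    (f ≫ kleisliOfHom T g).of = f.of ≫ T.map g := by
  simp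

end OfHom

namespace MonadStrength

open BraidedCategory

/-! ### Tensoring a Kleisli morphism with an object -/

section Left

variable {C : Type u} [Category.{v} C] [MonoidalCategory C] {T : Monad C} (s : MonadStrength T)

/-- The action `A ⊗ -` on Kleisli morphisms given by the strength. -/
def kleisliLeft (A : C) {X Y : Kleisli T} (f : X ⟶ Y) :
    Kleisli.mk T (A ⊗ X.of) ⟶ Kleisli.mk T (A ⊗ Y.of) :=
  Kleisli.Hom.mk (A ◁ f.of ≫ s.st A Y.of)

@[simp]
theorem kleisliLeft_of (A : C) {X Y : Kleisli T} (f : X ⟶ Y) :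
    (s.kleisliLeft A f).of = A ◁ f.of ≫ s.st A Y.of := rfl

theorem whiskerLeft_map_st (A : C) {B B' : C} (g : B ⟶ B') :
    A ◁ T.map g ≫ s.st A B' = s.st A B ≫ T.map (A ◁ g) := by
  simpa using s.st_naturality (𝟙 A) g

theorem whiskerRight_st {A A' : C} (f : A ⟶ A') (B : C) :
    f ▷ T.obj B ≫ s.st A' B = s.st A B ≫ T.map (f ▷ B) := by
  simpa using s.st_naturality f (𝟙 B)

theorem whiskerLeft_mu_st (A B : C) :
    A ◁ T.μ.app B ≫ s.st A B = s.st A (T.obj B) ≫ T.map (s.st A B) ≫ T.μ.app (A ⊗ B) := by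
  simpa using s.st_mu A B

theorem whiskerLeft_eta_st (A B : C) : A ◁ T.η.app B ≫ s.st A B = T.η.app (A ⊗ B) := by
  simpa using s.st_eta A B

theorem kleisliLeft_ofHom (A : C) {X Y : C} (f : X ⟶ Y) :
    s.kleisliLeft A (kleisliOfHom T f) = kleisliOfHom T (A ◁ f) := by
  ext
  simp [whiskerLeft_eta_st]

theorem kleisliLeft_id (A : C) (X : Kleisli T) :
    s.kleisliLeft A (𝟙 X) = 𝟙 (Kleisli.mk T (A ⊗ X.of)) := by
  ext
  simp [whiskerLeft_eta_st]

theorem kleisliLeft_comp (A : C) {X Y Z : Kleisli T} (f : X ⟶ Y) (g : Y ⟶ Z) :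
    s.kleisliLeft A (f ≫ g) = s.kleisliLeft A f ≫ s.kleisliLeft A g := by
  ext
  simp [whiskerLeft_mu_st, reassoc_of% @whiskerLeft_map_st]

theorem kleisliLeft_naturality {A A' : C} (a : A ⟶ A') {X Y : Kleisli T} (f : X ⟶ Y) :
    kleisliOfHom T (a ▷ X.of) ≫ s.kleisliLeft A' f =
      s.kleisliLeft A f ≫ kleisliOfHom T (a ▷ Y.of) := by
  ext
  rw [kleisliOfHom_comp_of, comp_kleisliOfHom_of]
  simp [← whiskerRight_st, whisker_exchange_assoc]

theorem kleisliLeft_tensor (A B : C) {X Y : Kleisli T} (f : X ⟶ Y) :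
    s.kleisliLeft (A ⊗ B) f =
      kleisliOfHom T (α_ A B X.of).hom ≫ s.kleisliLeft A (s.kleisliLeft B f) ≫
        kleisliOfHom T (α_ A B Y.of).inv := by
  ext
  rw [kleisliOfHom_comp_of, comp_kleisliOfHom_of]
  have h := s.st_assoc A B Y.of
  rw [id_tensorHom] at h
  simp [← h]

theorem kleisliLeft_kleisliLeft (A B : C) {X Y : Kleisli T} (f : X ⟶ Y) :
    s.kleisliLeft A (s.kleisliLeft B f) =
      kleisliOfHom T (α_ A B X.of).inv ≫ s.kleisliLeft (A ⊗ B) f ≫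
        kleisliOfHom T (α_ A B Y.of).hom := by
  simp [kleisliLeft_tensor, kleisliOfHom_comp, reassoc_of% @kleisliOfHom_comp, kleisliOfHom_id]

theorem kleisliLeft_associator (A B : C) {X Y : Kleisli T} (f : X ⟶ Y) :
    s.kleisliLeft (A ⊗ B) f ≫ kleisliOfHom T (α_ A B Y.of).hom =
      kleisliOfHom T (α_ A B X.of).hom ≫ s.kleisliLeft A (s.kleisliLeft B f) := by
  simp [kleisliLeft_tensor, kleisliOfHom_comp, kleisliOfHom_id]

theorem kleisliLeft_unit {X Y : Kleisli T} (f : X ⟶ Y) :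
    s.kleisliLeft (𝟙_ C) f ≫ kleisliOfHom T (λ_ Y.of).hom =
      kleisliOfHom T (λ_ X.of).hom ≫ f := by
  ext
  -- `Kleisli.mk T Y.of` agrees with `Y` only up to eta for structures, hence `erw`.
  erw [kleisliOfHom_comp_of, comp_kleisliOfHom_of]
  simp [s.st_unit]

end Left

section Right

variable {C : Type u} [Category.{v} C] [MonoidalCategory C] [SymmetricCategory C] {T : Monad C}
  (s : MonadStrength T)

/-- The action `- ⊗ A` on Kleisli morphisms, conjugate to `A ⊗ -` by the swap maps. -/
def kleisliRight {X Y : Kleisli T} (f : X ⟶ Y) (A : C) :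
    Kleisli.mk T (X.of ⊗ A) ⟶ Kleisli.mk T (Y.of ⊗ A) :=
  kleisliOfHom T (β_ X.of A).hom ≫ s.kleisliLeft A f ≫ kleisliOfHom T (β_ A Y.of).hom

theorem kleisliRight_of {X Y : Kleisli T} (f : X ⟶ Y) (A : C) :
    (s.kleisliRight f A).of = f.of ▷ A ≫ s.st' Y.of A := by
  rw [kleisliRight, kleisliOfHom_comp_of, comp_kleisliOfHom_of]
  simp [st']

theorem kleisliRight_ofHom {X Y : C} (f : X ⟶ Y) (A : C) :
    s.kleisliRight (kleisliOfHom T f) A = kleisliOfHom T (f ▷ A) := by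
  simp [kleisliRight, kleisliLeft_ofHom, kleisliOfHom_comp]

theorem kleisliRight_id (X : Kleisli T) (A : C) :
    s.kleisliRight (𝟙 X) A = 𝟙 (Kleisli.mk T (X.of ⊗ A)) := by
  simp [kleisliRight, kleisliLeft_id, kleisliOfHom_comp, kleisliOfHom_id]

theorem kleisliRight_braiding {X Y : Kleisli T} (f : X ⟶ Y) (A : C) :
    s.kleisliRight f A ≫ kleisliOfHom T (β_ Y.of A).hom =
      kleisliOfHom T (β_ X.of A).hom ≫ s.kleisliLeft A f := by
  simp [kleisliRight, kleisliOfHom_comp, kleisliOfHom_id]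

theorem kleisliLeft_braiding (A : C) {X Y : Kleisli T} (f : X ⟶ Y) :
    s.kleisliLeft A f ≫ kleisliOfHom T (β_ A Y.of).hom =
      kleisliOfHom T (β_ A X.of).hom ≫ s.kleisliRight f A := by
  simp [kleisliRight, reassoc_of% @kleisliOfHom_comp, kleisliOfHom_id]

theorem kleisliRight_comp {X Y Z : Kleisli T} (f : X ⟶ Y) (g : Y ⟶ Z) (A : C) :
    s.kleisliRight (f ≫ g) A = s.kleisliRight f A ≫ s.kleisliRight g A := by
  simp [kleisliRight, kleisliLeft_comp, reassoc_of% @kleisliOfHom_comp, kleisliOfHom_id]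

theorem kleisliRight_unit {X Y : Kleisli T} (f : X ⟶ Y) :
    s.kleisliRight f (𝟙_ C) ≫ kleisliOfHom T (ρ_ Y.of).hom =
      kleisliOfHom T (ρ_ X.of).hom ≫ f := by
  rw [← braiding_leftUnitor, ← braiding_leftUnitor, ← kleisliOfHom_comp, ← kleisliOfHom_comp,
    reassoc_of% @kleisliRight_braiding, kleisliLeft_unit, Category.assoc]

/-! ### Compatibility of the two actions with the associator -/

/-- Swapping the two factors of the object `A ⊗ B` acting on the left. -/
theorem kleisliLeft_swap (A B : C) {X Y : Kleisli T} (f : X ⟶ Y) :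
    s.kleisliLeft (A ⊗ B) f =
      kleisliOfHom T ((β_ A B).hom ▷ X.of) ≫ s.kleisliLeft (B ⊗ A) f ≫
        kleisliOfHom T ((β_ B A).hom ▷ Y.of) := by
  rw [reassoc_of% @kleisliLeft_naturality, kleisliOfHom_comp, ← comp_whiskerRight,
    SymmetricCategory.symmetry, id_whiskerRight, kleisliOfHom_id, Category.comp_id]

theorem kleisliRight_kleisliLeft_associator (A : C) {X Y : Kleisli T} (f : X ⟶ Y) (B : C) :
    s.kleisliRight (s.kleisliLeft A f) B ≫ kleisliOfHom T (α_ A Y.of B).hom =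
      kleisliOfHom T (α_ A X.of B).hom ≫ s.kleisliLeft A (s.kleisliRight f B) := by
  simp only [kleisliRight, kleisliLeft_comp, kleisliLeft_kleisliLeft, kleisliLeft_ofHom,
    s.kleisliLeft_swap A B, Category.assoc, kleisliOfHom_comp, reassoc_of% @kleisliOfHom_comp]
  congr 2
  · simp
  · congr 1
    simp

theorem kleisliRight_kleisliRight_associator {X Y : Kleisli T} (f : X ⟶ Y) (A B : C) :
    s.kleisliRight (s.kleisliRight f A) B ≫ kleisliOfHom T (α_ Y.of A B).hom =
      kleisliOfHom T (α_ X.of A B).hom ≫ s.kleisliRight f (A ⊗ B) := by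
  simp only [kleisliRight, kleisliLeft_comp, kleisliLeft_kleisliLeft, kleisliLeft_ofHom,
    s.kleisliLeft_swap A B, Category.assoc, kleisliOfHom_comp, reassoc_of% @kleisliOfHom_comp]
  congr 2
  -- Both remaining coherence conditions are the Yang–Baxter equation.
  · simp [← yang_baxter_assoc]
  · congr 1
    simp [← yang_baxter]

/-! ### The monoidal structure -/

theorem whiskerLeft_st' (A : C) {B B' : C} (g : B ⟶ B') :
    T.obj A ◁ g ≫ s.st' A B' = s.st' A B ≫ T.map (A ◁ g) := by
  simp only [st', Category.assoc, ← Functor.map_comp, braiding_naturality_right_assoc,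
    reassoc_of% @whiskerRight_st, braiding_naturality_left]

theorem kleisliRight_comp_kleisliLeft_of {X₁ Y₁ X₂ Y₂ : Kleisli T} (f : X₁ ⟶ Y₁) (g : X₂ ⟶ Y₂) :
    (s.kleisliRight f X₂.of ≫ s.kleisliLeft Y₁.of g).of =
      (f.of ⊗ₘ g.of) ≫ s.dst' Y₁.of Y₂.of := by
  simp [kleisliRight_of, dst', MonoidalCategory.tensorHom_def, reassoc_of% @whiskerLeft_st']

theorem kleisliLeft_comp_kleisliRight_of {X₁ Y₁ X₂ Y₂ : Kleisli T} (f : X₁ ⟶ Y₁) (g : X₂ ⟶ Y₂) :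
    (s.kleisliLeft X₁.of g ≫ s.kleisliRight f Y₂.of).of =
      (f.of ⊗ₘ g.of) ≫ s.dst Y₁.of Y₂.of := by
  simp [kleisliRight_of, dst, tensorHom_def', reassoc_of% @whiskerRight_st]

theorem kleisliTensorHom_eq' {X₁ Y₁ X₂ Y₂ : Kleisli T} (f : X₁ ⟶ Y₁) (g : X₂ ⟶ Y₂) :
    s.kleisliTensorHom f g = s.kleisliLeft X₁.of g ≫ s.kleisliRight f Y₂.of :=
  Kleisli.hom_ext (s.kleisliLeft_comp_kleisliRight_of f g).symm

variable {s}

theorem kleisliTensorHom_eq (hc : s.IsCommutative) {X₁ Y₁ X₂ Y₂ : Kleisli T}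
    (f : X₁ ⟶ Y₁) (g : X₂ ⟶ Y₂) :
    s.kleisliTensorHom f g = s.kleisliRight f X₂.of ≫ s.kleisliLeft Y₁.of g := by
  ext
  rw [kleisliRight_comp_kleisliLeft_of, ← hc]
  rfl

/-- The interchange law, which is where commutativity of the monad enters. -/
theorem kleisliRight_comp_kleisliLeft (hc : s.IsCommutative) {X₁ Y₁ X₂ Y₂ : Kleisli T}
    (f : X₁ ⟶ Y₁) (g : X₂ ⟶ Y₂) :
    s.kleisliRight f X₂.of ≫ s.kleisliLeft Y₁.of g =
      s.kleisliLeft X₁.of g ≫ s.kleisliRight f Y₂.of := by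
  rw [← kleisliTensorHom_eq hc, kleisliTensorHom_eq']

variable (s)

theorem kleisliTensorHom_id_left (X : Kleisli T) {Y Z : Kleisli T} (f : Y ⟶ Z) :
    s.kleisliTensorHom (𝟙 X) f = s.kleisliLeft X.of f := by
  rw [kleisliTensorHom_eq', kleisliRight_id, Category.comp_id]

theorem kleisliTensorHom_id_right {X Y : Kleisli T} (f : X ⟶ Y) (Z : Kleisli T) :
    s.kleisliTensorHom f (𝟙 Z) = s.kleisliRight f Z.of := by
  rw [kleisliTensorHom_eq', kleisliLeft_id, Category.id_comp]

variable {s}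

theorem kleisliTensorHom_comp (hc : s.IsCommutative) {X₁ Y₁ Z₁ X₂ Y₂ Z₂ : Kleisli T}
    (f₁ : X₁ ⟶ Y₁) (f₂ : X₂ ⟶ Y₂) (g₁ : Y₁ ⟶ Z₁) (g₂ : Y₂ ⟶ Z₂) :
    s.kleisliTensorHom f₁ f₂ ≫ s.kleisliTensorHom g₁ g₂ =
      s.kleisliTensorHom (f₁ ≫ g₁) (f₂ ≫ g₂) := by
  simp only [kleisliTensorHom_eq hc, kleisliRight_comp, kleisliLeft_comp, Category.assoc]
  rw [← reassoc_of% kleisliRight_comp_kleisliLeft hc g₁ f₂]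

theorem kleisliTensorHom_associator (hc : s.IsCommutative) {X₁ X₂ X₃ Y₁ Y₂ Y₃ : Kleisli T}
    (f₁ : X₁ ⟶ Y₁) (f₂ : X₂ ⟶ Y₂) (f₃ : X₃ ⟶ Y₃) :
    s.kleisliTensorHom (s.kleisliTensorHom f₁ f₂) f₃ ≫
        kleisliOfHom T (α_ Y₁.of Y₂.of Y₃.of).hom =
      kleisliOfHom T (α_ X₁.of X₂.of X₃.of).hom ≫
        s.kleisliTensorHom f₁ (s.kleisliTensorHom f₂ f₃) := by
  simp only [kleisliTensorHom_eq hc, kleisliRight_comp, kleisliLeft_comp, Category.assoc]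
  rw [kleisliLeft_associator, ← Category.assoc (s.kleisliRight (s.kleisliLeft _ _) _),
    kleisliRight_kleisliLeft_associator, Category.assoc,
    ← Category.assoc (s.kleisliRight (s.kleisliRight _ _) _),
    kleisliRight_kleisliRight_associator, Category.assoc]

/-- The monoidal structure on the Kleisli category of a commutative strong monad. -/
abbrev kleisliMonoidalCategory (hc : s.IsCommutative) : MonoidalCategory (Kleisli T) where
  toMonoidalCategoryStruct := s.kleisliMonoidalStruct
  tensorHom_def {X₁ Y₁ X₂ Y₂} f g := by
    change s.kleisliTensorHom f g =
      s.kleisliTensorHom f (𝟙 X₂) ≫ s.kleisliTensorHom (𝟙 Y₁) g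
    rw [kleisliTensorHom_comp hc, Category.comp_id, Category.id_comp]
  id_tensorHom_id X Y := (s.kleisliTensorHom_id_left X (𝟙 Y)).trans (s.kleisliLeft_id X.of Y)
  tensorHom_comp_tensorHom := kleisliTensorHom_comp hc
  whiskerLeft_id X Y := (s.kleisliTensorHom_id_left X (𝟙 Y)).trans (s.kleisliLeft_id X.of Y)
  id_whiskerRight X Y := (s.kleisliTensorHom_id_left X (𝟙 Y)).trans (s.kleisliLeft_id X.of Y)
  associator_naturality := kleisliTensorHom_associator hc
  leftUnitor_naturality {X Y} f :=
    (congrArg (· ≫ kleisliOfHom T (λ_ Y.of).hom)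
      (s.kleisliTensorHom_id_left (Kleisli.mk T (𝟙_ C)) f)).trans (s.kleisliLeft_unit f)
  rightUnitor_naturality {X Y} f :=
    (congrArg (· ≫ kleisliOfHom T (ρ_ Y.of).hom)
      (s.kleisliTensorHom_id_right f (Kleisli.mk T (𝟙_ C)))).trans (s.kleisliRight_unit f)
  pentagon W X Y Z := by
    change s.kleisliTensorHom (kleisliOfHom T (α_ W.of X.of Y.of).hom) (𝟙 Z) ≫
        kleisliOfHom T (α_ W.of (X.of ⊗ Y.of) Z.of).hom ≫
          s.kleisliTensorHom (𝟙 W) (kleisliOfHom T (α_ X.of Y.of Z.of).hom) =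
      kleisliOfHom T (α_ (W.of ⊗ X.of) Y.of Z.of).hom ≫
        kleisliOfHom T (α_ W.of X.of (Y.of ⊗ Z.of)).hom
    simp [kleisliTensorHom_id_left, kleisliTensorHom_id_right, kleisliLeft_ofHom,
      kleisliRight_ofHom, kleisliOfHom_comp]
  triangle X Y := by
    change kleisliOfHom T (α_ X.of (𝟙_ C) Y.of).hom ≫
        s.kleisliTensorHom (𝟙 X) (kleisliOfHom T (λ_ Y.of).hom) =
      s.kleisliTensorHom (kleisliOfHom T (ρ_ X.of).hom) (𝟙 Y)
    simp [kleisliTensorHom_id_left, kleisliTensorHom_id_right, kleisliLeft_ofHom,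
      kleisliRight_ofHom, kleisliOfHom_comp]

theorem isMonoidalStruct_kleisli (hc : s.IsCommutative) :
    IsMonoidalStruct s.kleisliMonoidalStruct :=
  ⟨kleisliMonoidalCategory hc, rfl⟩

/-- The symmetry on the Kleisli category, given by the images of the swap maps of `C`. -/
abbrev kleisliSymmetricCategory (hM : IsMonoidalStruct s.kleisliMonoidalStruct) :
    letI : MonoidalCategory (Kleisli T) := hM.monoidalCategory
    SymmetricCategory (Kleisli T) :=
  letI : MonoidalCategory (Kleisli T) := hM.monoidalCategory
  { braiding X Y := (Kleisli.Adjunction.toKleisli T).mapIso (β_ X.of Y.of)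
    braiding_naturality_right X Y Z f := by
      change s.kleisliTensorHom (𝟙 X) f ≫ kleisliOfHom T (β_ X.of Z.of).hom =
        kleisliOfHom T (β_ X.of Y.of).hom ≫ s.kleisliTensorHom f (𝟙 X)
      rw [kleisliTensorHom_id_left, kleisliTensorHom_id_right, kleisliLeft_braiding]
    braiding_naturality_left {X Y} f Z := by
      change s.kleisliTensorHom f (𝟙 Z) ≫ kleisliOfHom T (β_ Y.of Z.of).hom =
        kleisliOfHom T (β_ X.of Z.of).hom ≫ s.kleisliTensorHom (𝟙 Z) f
      rw [kleisliTensorHom_id_left, kleisliTensorHom_id_right, kleisliRight_braiding]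
    hexagon_forward X Y Z := by
      change kleisliOfHom T (α_ X.of Y.of Z.of).hom ≫
          kleisliOfHom T (β_ X.of (Y.of ⊗ Z.of)).hom ≫ kleisliOfHom T (α_ Y.of Z.of X.of).hom =
        s.kleisliTensorHom (kleisliOfHom T (β_ X.of Y.of).hom) (𝟙 Z) ≫
          kleisliOfHom T (α_ Y.of X.of Z.of).hom ≫
            s.kleisliTensorHom (𝟙 Y) (kleisliOfHom T (β_ X.of Z.of).hom)
      simp only [kleisliTensorHom_id_left, kleisliTensorHom_id_right, kleisliLeft_ofHom,
        kleisliRight_ofHom, kleisliOfHom_comp, hexagon_forward]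
    hexagon_reverse X Y Z := by
      change kleisliOfHom T (α_ X.of Y.of Z.of).inv ≫
          kleisliOfHom T (β_ (X.of ⊗ Y.of) Z.of).hom ≫ kleisliOfHom T (α_ Z.of X.of Y.of).inv =
        s.kleisliTensorHom (𝟙 X) (kleisliOfHom T (β_ Y.of Z.of).hom) ≫
          kleisliOfHom T (α_ X.of Z.of Y.of).inv ≫
            s.kleisliTensorHom (kleisliOfHom T (β_ X.of Z.of).hom) (𝟙 Y)
      simp only [kleisliTensorHom_id_left, kleisliTensorHom_id_right, kleisliLeft_ofHom,
        kleisliRight_ofHom, kleisliOfHom_comp, hexagon_reverse]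
    symmetry X Y := by
      change kleisliOfHom T (β_ X.of Y.of).hom ≫ kleisliOfHom T (β_ Y.of X.of).hom =
        𝟙 (Kleisli.mk T (X.of ⊗ Y.of))
      rw [kleisliOfHom_comp, SymmetricCategory.symmetry, kleisliOfHom_id] }

end Right

end MonadStrength

/-! ### The dagger on the Kleisli category -/
/-! ### The dagger on the Kleisli category -/

section Dagger

variable {C : Type u} [Category.{v} C] [DaggerCategory C] {T : Monad C}

namespace IsFrobeniusMonad

/-- Naturality of `μ†`, the dagger of the naturality of `μ` at `f†`. -/
theorem dag_mu_naturality (hT : IsFrobeniusMonad T) {A B : C} (f : A ⟶ B) :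
    dag (T.μ.app A) ≫ T.map (T.map f) = T.map f ≫ dag (T.μ.app B) := by
  have h := congrArg dag (T.μ.naturality (dag f))
  simpa [dag_comp, dag_dag, ← hT.map_dag] using h

theorem dag_mu_comp_map_dag_eta (hT : IsFrobeniusMonad T) (A : C) :
    dag (T.μ.app A) ≫ T.map (dag (T.η.app A)) = 𝟙 (T.obj A) := by
  rw [hT.map_dag, ← dag_comp, T.right_unit]
  exact dag_id _

/-- Coassociativity of `μ†`. -/
theorem dag_mu_comp_map_dag_mu (hT : IsFrobeniusMonad T) (A : C) :
    dag (T.μ.app A) ≫ T.map (dag (T.μ.app A)) =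
      dag (T.μ.app A) ≫ dag (T.μ.app (T.obj A)) := by
  rw [hT.map_dag, ← dag_comp, T.assoc, dag_comp]

/-- The Frobenius law expresses `T(μ†) ≫ μ` as `μ† ≫ T(μ)`, and the unit `T(η)` then cancels `T(μ)`
by naturality of `μ†`. -/
theorem map_eta_comp_map_dag_mu_comp_mu (hT : IsFrobeniusMonad T) (A : C) :
    T.map (T.η.app A) ≫ T.map (dag (T.μ.app A)) ≫ T.μ.app (T.obj A) = dag (T.μ.app A) := by
  have h : T.map (T.map (T.η.app A)) ≫ T.map (T.μ.app A) = 𝟙 (T.obj (T.obj A)) := by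
    rw [← Functor.map_comp, T.right_unit]
    exact T.map_id _
  rw [← hT.frobenius, ← reassoc_of% hT.dag_mu_naturality, h]
  exact Category.comp_id _

end IsFrobeniusMonad

theorem kleisliDag_comp (hT : IsFrobeniusMonad T) {X Y Z : Kleisli T} (f : X ⟶ Y) (g : Y ⟶ Z) :
    kleisliDag T (f ≫ g) = kleisliDag T g ≫ kleisliDag T f := by
  ext
  simp only [kleisliDag, Kleisli.category_comp_of, dag_comp, Functor.map_comp, Category.assoc,
    T.mu_naturality, reassoc_of% hT.map_eta_comp_map_dag_mu_comp_mu,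
    reassoc_of% hT.dag_mu_comp_map_dag_mu,
    ← hT.map_dag, reassoc_of% hT.dag_mu_naturality]

theorem kleisliDag_kleisliDag (hT : IsFrobeniusMonad T) {X Y : Kleisli T} (f : X ⟶ Y) :
    kleisliDag T (kleisliDag T f) = f := by
  ext
  -- The other unit law of `μ` turns the Frobenius composite into `μ†`.
  have h : T.η.app (T.obj Y.of) ≫ T.map (dag (T.μ.app Y.of)) ≫ T.μ.app (T.obj Y.of) =
      dag (T.μ.app Y.of) := by
    have := T.η.naturality (dag (T.μ.app Y.of))
    simp only [Functor.id_map] at this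
    rw [← reassoc_of% this]
    simp
  simp only [kleisliDag, dag_comp, Functor.map_comp, dag_dag, Category.assoc, ← hT.map_dag,
    reassoc_of% hT.dag_mu_naturality]
  have h' := T.η.naturality f.of
  simp only [Functor.id_map] at h'
  rw [← reassoc_of% h', reassoc_of% hT.frobenius Y.of, reassoc_of% h, hT.dag_mu_comp_map_dag_eta]
  exact Category.comp_id _

/-- The Kleisli dagger extends the dagger of `C`. -/
theorem kleisliDag_ofHom (hT : IsFrobeniusMonad T) {A B : C} (f : A ⟶ B) :
    kleisliDag T (kleisliOfHom T f) = kleisliOfHom T (dag f) := by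
  ext
  have h' := T.η.naturality (dag f)
  simp only [Functor.id_map] at h'
  simp [kleisliDag, dag_comp, reassoc_of% hT.dag_mu_comp_map_dag_eta, h']

/-- The dagger on the Kleisli category of a Frobenius monad. -/
abbrev kleisliDaggerCategory (hT : IsFrobeniusMonad T) : DaggerCategory (Kleisli T) where
  dag f := kleisliDag T f
  dag_id X := by
    rw [← kleisliOfHom_id, kleisliDag_ofHom hT, dag_id]
  dag_comp := kleisliDag_comp hT
  dag_dag := kleisliDag_kleisliDag hT

theorem isUnitary_kleisliOfHom (hT : IsFrobeniusMonad T) {A B : C} {f : A ⟶ B}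
    (hf : IsUnitary f) :
    letI := kleisliDaggerCategory hT
    IsUnitary (kleisliOfHom T f) :=
  letI := kleisliDaggerCategory hT
  { hom_dag := by
      change kleisliOfHom T f ≫ kleisliDag T (kleisliOfHom T f) = _
      rw [kleisliDag_ofHom hT, kleisliOfHom_comp, hf.hom_dag, kleisliOfHom_id]
    dag_hom := by
      change kleisliDag T (kleisliOfHom T f) ≫ kleisliOfHom T f = _
      rw [kleisliDag_ofHom hT, kleisliOfHom_comp, hf.dag_hom, kleisliOfHom_id] }

end Dagger

/-! ### Compatibility of the dagger with the tensor product -/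

section MonoidalDagger

variable {C : Type u} [Category.{v} C] [MonoidalCategory C] [DaggerCategory C] {T : Monad C}
  {s : MonadStrength T}

theorem dag_whiskerLeft [IsMonoidalDagger C] (A : C) {X Y : C} (f : X ⟶ Y) :
    dag (A ◁ f) = A ◁ dag f := by
  rw [← id_tensorHom, IsMonoidalDagger.dag_tensor, dag_id, id_tensorHom]

/-- The dagger of the compatibility of the strength with `μ`, where unitarity allows moving the
strengths to the other side. -/
theorem IsStrongFrobeniusMonad.whiskerLeft_dag_mu_st [IsMonoidalDagger C]
    (hT : IsStrongFrobeniusMonad T s) (A B : C) :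
    A ◁ dag (T.μ.app B) ≫ s.st A (T.obj B) =
      s.st A B ≫ dag (T.μ.app (A ⊗ B)) ≫ T.map (dag (s.st A B)) := by
  have h := congrArg dag (s.whiskerLeft_mu_st A B)
  simp only [dag_comp, dag_whiskerLeft, Category.assoc, ← hT.map_dag] at h
  calc A ◁ dag (T.μ.app B) ≫ s.st A (T.obj B)
      = s.st A B ≫ (dag (s.st A B) ≫ A ◁ dag (T.μ.app B)) ≫ s.st A (T.obj B) := by
        rw [Category.assoc, ← Category.assoc (s.st A B), (hT.unitary_st A B).hom_dag,
          Category.id_comp]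
    _ = _ := by
        rw [h, Category.assoc, Category.assoc, (hT.unitary_st A (T.obj B)).dag_hom,
          Category.comp_id]

theorem kleisliDag_kleisliLeft [IsMonoidalDagger C] (hT : IsStrongFrobeniusMonad T s) (A : C)
    {X Y : Kleisli T} (f : X ⟶ Y) :
    kleisliDag T (s.kleisliLeft A f) = s.kleisliLeft A (kleisliDag T f) := by
  ext
  simp only [kleisliDag, MonadStrength.kleisliLeft_of, dag_comp, dag_whiskerLeft,
    Functor.map_comp, whiskerLeft_comp, Category.assoc, s.whiskerLeft_map_st,
    reassoc_of% hT.whiskerLeft_dag_mu_st, reassoc_of% s.whiskerLeft_eta_st]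

variable [SymmetricCategory C] [IsSymmetricMonoidalDagger C]

theorem dag_braiding (A B : C) : dag (β_ A B).hom = (β_ B A).hom := by
  rw [← cancel_epi (β_ A B).hom, SymmetricCategory.symmetry,
    (IsSymmetricMonoidalDagger.unitary_braiding A B).hom_dag]

theorem kleisliDag_kleisliRight (hT : IsStrongFrobeniusMonad T s) {X Y : Kleisli T} (f : X ⟶ Y)
    (A : C) :
    kleisliDag T (s.kleisliRight f A) = s.kleisliRight (kleisliDag T f) A := by
  have hF := hT.toIsFrobeniusMonad
  simp only [MonadStrength.kleisliRight, kleisliDag_comp hF, kleisliDag_ofHom hF,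
    kleisliDag_kleisliLeft hT, dag_braiding, Category.assoc]

theorem kleisliDag_kleisliTensorHom (hT : IsStrongFrobeniusMonad T s) (hc : s.IsCommutative)
    {X₁ Y₁ X₂ Y₂ : Kleisli T} (f : X₁ ⟶ Y₁) (g : X₂ ⟶ Y₂) :
    kleisliDag T (s.kleisliTensorHom f g) =
      s.kleisliTensorHom (kleisliDag T f) (kleisliDag T g) := by
  rw [MonadStrength.kleisliTensorHom_eq hc, kleisliDag_comp hT.toIsFrobeniusMonad,
    kleisliDag_kleisliLeft hT, kleisliDag_kleisliRight hT, MonadStrength.kleisliTensorHom_eq']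

end MonoidalDagger

theorem mainTheorem4 {C : Type u} [Category.{v} C] [MonoidalCategory C] [SymmetricCategory C]
    [DaggerCategory C] [IsSymmetricMonoidalDagger C]
    (T : Monad C) (s : MonadStrength T)
    (hT : IsStrongFrobeniusMonad T s) (hc : s.IsCommutative) :
    ∃ hM : IsMonoidalStruct s.kleisliMonoidalStruct,
      letI : MonoidalCategory (Kleisli T) := hM.monoidalCategory
      ∃ (_ : SymmetricCategory (Kleisli T)) (_ : DaggerCategory (Kleisli T)),
        (∀ X Y : Kleisli T,
          β_ X Y = (Kleisli.Adjunction.toKleisli T).mapIso (β_ X.of Y.of)) ∧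
        (∀ {X Y : Kleisli T} (f : X ⟶ Y), dag f = kleisliDag T f) ∧
        IsSymmetricMonoidalDagger (Kleisli T) := by
  have hF := hT.toIsFrobeniusMonad
  refine ⟨MonadStrength.isMonoidalStruct_kleisli hc, MonadStrength.kleisliSymmetricCategory _,
    kleisliDaggerCategory hF, fun _ _ => rfl, fun _ => rfl, ?_⟩
  let : MonoidalCategory (Kleisli T) :=
    (MonadStrength.isMonoidalStruct_kleisli hc).monoidalCategory
  let : SymmetricCategory (Kleisli T) :=
    MonadStrength.kleisliSymmetricCategory (MonadStrength.isMonoidalStruct_kleisli hc)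
  let := kleisliDaggerCategory hF
  exact
    { dag_tensor := fun f g => kleisliDag_kleisliTensorHom hT hc f g
      unitary_associator := fun X Y Z =>
        isUnitary_kleisliOfHom hF (IsMonoidalDagger.unitary_associator X.of Y.of Z.of)
      unitary_leftUnitor := fun X =>
        isUnitary_kleisliOfHom hF (IsMonoidalDagger.unitary_leftUnitor X.of)
      unitary_rightUnitor := fun X =>
        isUnitary_kleisliOfHom hF (IsMonoidalDagger.unitary_rightUnitor X.of)
      unitary_braiding := fun X Y =>
        isUnitary_kleisliOfHom hF (IsSymmetricMonoidalDagger.unitary_braiding X.of Y.of) }
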